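/- Let $m\ge 1$ be a fixed integer and, for $n\ge 0$, let $$Q_{n,m}(z)=\sum_{k=0}^{n}\binom{n+m}{k+m}z^k .$$ Then, as $n\to\infty$, $$\frac{Q_{n,m}(z)}{n^{m-1}}=\begin{cases}\dfrac{(z+1)^{n+m}}{n^{m-1}z^m}\,(1+o(1)) & \text{if } |z+1|>1,\\[2mm] -\dfrac{1}{z\,(m-1)!}\,(1+o(1)) & \text{if } |z+1|<1,\end{cases}$$ uniformly on compact subsets of each of the two regions. Moreover, the zero counting measures $$\nu[Q_{n,m}]=\frac1n\sum_{\zeta:\,Q_{n,m}(\zeta)=0}\delta_\zeta$$ (zeros counted with multiplicity) satisfy $\int f\,d\nu[Q_{n,m}]\to\int f\,d\mu$ as $n\to\infty$ for every bounded continuous $f:\mathbb C\to\mathbb R$, where $\mu$ is the normalized arc length $d\theta/(2\pi)$ on the circle $|z+1|=1$. The measure $\mu$ is the equilibrium measure of the closed disc $|z+1|\le 1$, and also of its boundary circle $|z+1|=1$; that is, $\mu$ is, for each of these two compact sets, the unique minimizer of the logarithmic energy $\iint\log\frac{1}{|z-w|}\,d\nu(z)\,d\nu(w)\in(-\infty,+\infty]$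 among the Borel probability measures $\nu$ carried by the set. -/

import Mathlib

open Filter Topology MeasureTheory Polynomial
open scoped ENNReal

noncomputable section

namespace IteratedIntegral

/-- The Borwein–Chen–Dilcher polynomial `Q_{n,m}(z) = ∑_{k=0}^n binom(n+m, k+m) z^k`. -/
def Q (n m : ℕ) : ℂ[X] :=
  ∑ k ∈ Finset.range (n + 1), C ((Nat.choose (n + m) (k + m) : ℕ) : ℂ) * X ^ k

/-- The normalized zero counting measure `ν[p]` of a polynomial `p`: mass `1 / deg p` at each zero,
zeros being repeated according to multiplicity. -/
def zeroMeasure (p : ℂ[X]) : Measure ℂ :=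
  (p.natDegree : ℝ≥0∞)⁻¹ • (p.roots.map fun ζ => Measure.dirac ζ).sum

/-- Normalized arc length `dθ / (2π)` on the circle with center `c` and radius `R`. -/
def normalizedArcLength (c : ℂ) (R : ℝ) : Measure ℂ :=
  (ENNReal.ofReal (2 * Real.pi))⁻¹ •
    (volume.restrict (Set.Ioc 0 (2 * Real.pi))).map (circleMap c R)

/-- The logarithmic kernel `log (1 / |z - w|)`, equal to `+∞` when `z = w`. -/
def logKernel (z w : ℂ) : EReal := -ENNReal.log ‖z - w‖ₑ

/-- The logarithmic energy `∬ log (1 / |z - w|) dμ(z) dμ(w)`, as the integral of the positive part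
minus that of the negative part. For a finite measure on a compact set, the second one is finite. -/
def logEnergy (μ : Measure ℂ) : EReal :=
  ((∫⁻ z, ∫⁻ w, (logKernel z w).toENNReal ∂μ ∂μ : ℝ≥0∞) : EReal) -
    ((∫⁻ z, ∫⁻ w, (-logKernel z w).toENNReal ∂μ ∂μ : ℝ≥0∞) : EReal)

/-- `μ` is the equilibrium measure of the compact set `K`: the unique minimizer of the logarithmic
energy among the Borel probability measures carried by `K`. -/
structure IsEquilibriumMeasure (K : Set ℂ) (μ : Measure ℂ) : Prop where
  isProbabilityMeasure : IsProbabilityMeasure μ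
  carried : μ Kᶜ = 0
  energy_lt : ∀ ν : Measure ℂ, IsProbabilityMeasure ν → ν Kᶜ = 0 → ν ≠ μ →
    logEnergy μ < logEnergy ν

/-- `f n z = g n z * (1 + o(1))` as `n → ∞`, uniformly on compact subsets of `U`
(the identity being required for all `n ≥ 1`). -/
def AsympOnCompacts (f g : ℕ → ℂ → ℂ) (U : Set ℂ) : Prop :=
  ∃ ε : ℕ → ℂ → ℂ,
    (∀ n : ℕ, 1 ≤ n → ∀ z ∈ U, f n z = g n z * (1 + ε n z)) ∧
    ∀ K : Set ℂ, K ⊆ U → IsCompact K → TendstoUniformlyOn ε (fun _ => 0) atTop K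

end IteratedIntegral

end

/-!
Write `w = z + 1`. The binomial theorem gives `z ^ m * Q n m z = w ^ (n + m) - L(z)`, where `L` is
the part of degree less than `m` of the expansion of `(z + 1) ^ (n + m)` (`X_pow_mul_Q`).

*Asymptotics.* Where `|w| > 1`, the power `w ^ (n + m)` beats `L`, whose size is polynomial in `n`
(`asympOnCompacts_Q_outside`); where `|w| < 1`, the power is negligible and the top term of `L`, of
order `n ^ (m - 1)`, dominates (`asympOnCompacts_Q_inside`).

*Zeros.* The same estimates push all zeros into any given annulus around `|w| = 1`
(`eventually_abs_norm_root_Q_sub_one_le`). In the variable `w` the polynomial `w ^ (n + m) - L` has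
no terms of degree between `m` and `n + m - 1`, so Newton's identities show that the sum of `w ^ k`
over the zeros of `Q n m` is exactly `-m` for `1 ≤ k ≤ n` (`sum_roots_Q_add_one_pow`). After
division by `n` the moments tend to `0`, and measures concentrating near a circle whose moments of
positive order tend to `0` converge to arc length, because trigonometric polynomials are dense
(`tendsto_integral_normalizedArcLength`).

*Equilibrium.* For `a`, `b` in the closed unit disc,
`|1 - a b̄|² = |a - b|² + (1 - |a|²) (1 - |b|²)`, whence
`log (1 / |a - b|) ≥ log (1 / |1 - a b̄|) + (1 - |a|²) (1 - |b|²) / 8`. The kernel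
`log (1 / |1 - a b̄|)` is the sum of `Re ((a b̄) ^ k) / k`, so the energy of a probability measure on
the disc is at least `|mₖ|² / k + (∫ (1 - |a|²))² / 8` for each of its moments `mₖ`, `k ≥ 1`.
Hence it is positive unless the measure lies on the circle and has vanishing moments, that is,
unless it is arc length (`logEnergy_pos`), whose own energy is `0` because its potential
vanishes on the disc (`logEnergy_normalizedArcLength`). Inserting a factor `r < 1` in front of
`a b̄` makes all the kernels bounded (`kernelMinorant`).
-/

namespace IteratedIntegral


/-! ### Normalized arc length -/

theorem isProbabilityMeasure_normalizedArcLength (c : ℂ) (R : ℝ) :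
    IsProbabilityMeasure (normalizedArcLength c R) := by
  have h : AEMeasurable (circleMap c R) (volume.restrict (Set.Ioc 0 (2 * Real.pi))) :=
    (continuous_circleMap c R).aemeasurable
  constructor
  rw [normalizedArcLength, Measure.smul_apply, Measure.map_apply_of_aemeasurable h .univ]
  simp only [Set.preimage_univ, Measure.restrict_apply_univ, Real.volume_Ioc, sub_zero, smul_eq_mul]
  exact ENNReal.inv_mul_cancel (by simp [Real.pi_pos]) ENNReal.ofReal_ne_top

theorem ae_normalizedArcLength {c : ℂ} {R : ℝ} (hR : 0 ≤ R) :
    ∀ᵐ z ∂normalizedArcLength c R, z ∈ Metric.sphere c R := by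
  refine Measure.ae_smul_measure ?_ _
  refine (ae_map_iff (p := fun z => z ∈ Metric.sphere c R) (continuous_circleMap c R).aemeasurable
    Metric.isClosed_sphere.measurableSet).2 ?_
  exact Eventually.of_forall fun θ => circleMap_mem_sphere c hR θ

theorem integral_normalizedArcLength {E : Type*} [NormedAddCommGroup E] [NormedSpace ℝ E]
    {c : ℂ} {R : ℝ} {f : ℂ → E} (hf : StronglyMeasurable f) :
    ∫ z, f z ∂normalizedArcLength c R = Real.circleAverage f c R := by
  rw [normalizedArcLength, integral_smul_measure,
    integral_map (continuous_circleMap c R).aemeasurable hf.aestronglyMeasurable,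
    Real.circleAverage_def, intervalIntegral.integral_of_le (by positivity), ENNReal.toReal_inv,
    ENNReal.toReal_ofReal (by positivity)]

theorem integral_normalizedArcLength_pow {c : ℂ} {k : ℕ} (hk : 1 ≤ k) :
    ∫ z, (z - c) ^ k ∂normalizedArcLength c 1 = 0 := by
  rw [integral_normalizedArcLength
    (Continuous.stronglyMeasurable (f := fun z : ℂ => (z - c) ^ k) (by fun_prop))]
  have h : DiffContOnCl ℂ (fun z : ℂ => (z - c) ^ k) (Metric.ball c |1|) :=
    Differentiable.diffContOnCl (by fun_prop)
  rw [h.circleAverage]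
  simp [show k ≠ 0 by omega]

/-! ### Convergence to arc length through moments -/

theorem integrable_of_ae_abs_norm_sub_le {E : Type*} [NormedAddCommGroup E]
    {c : ℂ} {ν : Measure ℂ} [IsFiniteMeasure ν]
    (h : ∀ᵐ z ∂ν, |‖z - c‖ - 1| ≤ 1) {g : ℂ → E} (hg : Continuous g) : Integrable g ν := by
  obtain ⟨C, hC⟩ := (isCompact_closedBall c 2).exists_bound_of_continuousOn hg.continuousOn
  refine Integrable.of_bound hg.aestronglyMeasurable C ?_
  filter_upwards [h] with z hz
  refine hC z ?_
  rw [mem_closedBall_iff_norm]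
  linarith [(abs_le.1 hz).2]

theorem exists_fourier_one_eq {c z : ℂ} (hz : ‖z - c‖ = 1) :
    ∃ x : AddCircle (2 * Real.pi), c + fourier 1 x = z := by
  refine ⟨((z - c).arg : ℝ), ?_⟩
  have h := Complex.norm_mul_exp_arg_mul_I (z - c)
  rw [hz] at h
  rw [fourier_coe_apply]
  have h2 : (2 * Real.pi * Complex.I * ((1 : ℤ) : ℂ) * ((z - c).arg : ℂ) / ((2 * Real.pi : ℝ) : ℂ))
      = (z - c).arg * Complex.I := by
    have : (Real.pi : ℂ) ≠ 0 := by exact_mod_cast Real.pi_ne_zero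
    push_cast
    field_simp
  rw [h2]
  rw [Complex.ofReal_one, one_mul] at h
  rw [h]
  ring

/-- A trigonometric polynomial on the circle `|z - c| = 1` extends to a polynomial in `z - c` and
its conjugate without mixed terms; convergence of the moments therefore gives convergence of its
integrals. -/
theorem exists_extension_of_mem_span_fourier {c : ℂ} {ν : ℕ → Measure ℂ}
    (hν : ∀ n, IsProbabilityMeasure (ν n))
    (hcirc : ∀ᶠ n in atTop, ∀ᵐ z ∂ν n, |‖z - c‖ - 1| ≤ 1)
    (hmom : ∀ k : ℕ, 1 ≤ k → Tendsto (fun n => ∫ z, (z - c) ^ k ∂ν n) atTop (𝓝 0))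
    {T : C(AddCircle (2 * Real.pi), ℂ)}
    (hT : T ∈ Submodule.span ℂ (Set.range <| @fourier (2 * Real.pi))) :
    ∃ g : ℂ → ℂ, Continuous g ∧ (∀ x, g (c + fourier 1 x) = T x) ∧
      Tendsto (fun n => ∫ z, g z ∂ν n) atTop (𝓝 (∫ z, g z ∂normalizedArcLength c 1)) := by
  have := isProbabilityMeasure_normalizedArcLength c 1
  have hμ : ∀ᵐ z ∂normalizedArcLength c 1, |‖z - c‖ - 1| ≤ 1 := by
    filter_upwards [ae_normalizedArcLength (c := c) zero_le_one] with z hz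
    rw [mem_sphere_iff_norm.1 hz]
    norm_num
  induction hT using Submodule.span_induction with
  | mem T hT =>
    obtain ⟨k, rfl⟩ := hT
    have hpow : ∀ j : ℕ, 1 ≤ j → Tendsto (fun n => ∫ z, (z - c) ^ j ∂ν n) atTop
        (𝓝 (∫ z, (z - c) ^ j ∂normalizedArcLength c 1)) := fun j hj => by
      rw [integral_normalizedArcLength_pow hj]
      exact hmom j hj
    have hfour : ∀ (j : ℕ) (x : AddCircle (2 * Real.pi)),
        (fourier 1 x : ℂ) ^ j = fourier (j : ℤ) x := fun j x => by
      simp [fourier_apply, AddCircle.toCircle_nsmul]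
    rcases lt_trichotomy k 0 with hk | rfl | hk
    · obtain ⟨j, rfl⟩ : ∃ j : ℕ, k = -(j : ℤ) := ⟨k.natAbs, by omega⟩
      refine ⟨fun z => (starRingEnd ℂ) ((z - c) ^ j), by fun_prop, fun x => ?_, ?_⟩
      · simp only [add_sub_cancel_left, hfour, fourier_neg]
      · simp only [integral_conj]
        exact (Complex.continuous_conj.tendsto _).comp (hpow j (by omega))
    · refine ⟨fun _ => 1, continuous_const, fun x => by simp, ?_⟩
      simp
    · obtain ⟨j, rfl⟩ : ∃ j : ℕ, k = (j : ℤ) := ⟨k.natAbs, by omega⟩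
      refine ⟨fun z => (z - c) ^ j, by fun_prop, fun x => ?_, hpow j (by omega)⟩
      simp only [add_sub_cancel_left, hfour]
  | zero => exact ⟨fun _ => 0, continuous_const, fun x => rfl, by simp⟩
  | add S T _ _ hS hT =>
    obtain ⟨g, hg, hgS, hglim⟩ := hS
    obtain ⟨h, hh, hhT, hhlim⟩ := hT
    refine ⟨fun z => g z + h z, hg.add hh, fun x => by
      simp only [hgS, hhT, ContinuousMap.add_apply], ?_⟩
    rw [integral_add (integrable_of_ae_abs_norm_sub_le hμ hg)
      (integrable_of_ae_abs_norm_sub_le hμ hh)]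
    refine (hglim.add hhlim).congr' ?_
    filter_upwards [hcirc] with n hn
    rw [integral_add (integrable_of_ae_abs_norm_sub_le hn hg)
      (integrable_of_ae_abs_norm_sub_le hn hh)]
  | smul a T _ hT =>
    obtain ⟨g, hg, hgT, hglim⟩ := hT
    refine ⟨fun z => a * g z, hg.const_mul a, fun x => by
      simp only [hgT, ContinuousMap.smul_apply, smul_eq_mul], ?_⟩
    simp only [integral_const_mul]
    exact hglim.const_mul a

/-- The closeness of two continuous functions on the circle `|z - c| = 1` persists on an annulus. -/
theorem exists_annulus_norm_sub_lt {c : ℂ} {f g : ℂ → ℂ} (hf : Continuous f) (hg : Continuous g)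
    {ε : ℝ} (h : ∀ z, ‖z - c‖ = 1 → ‖f z - g z‖ < ε) :
    ∃ δ > 0, δ < 1 ∧ ∀ z, |‖z - c‖ - 1| ≤ δ → ‖f z - g z‖ < ε := by
  have hopen : IsOpen {z : ℂ | ‖f z - g z‖ < ε} :=
    isOpen_lt (hf.sub hg).norm continuous_const
  obtain ⟨δ, hδ, hsub⟩ := (isCompact_sphere c 1).exists_thickening_subset_open hopen
    fun z hz => h z (mem_sphere_iff_norm.1 hz)
  refine ⟨min (δ / 2) (1 / 2), by positivity, by
    linarith [min_le_right (δ / 2) (1 / 2 : ℝ)], fun z hz => hsub ?_⟩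
  have h1 := hz.trans (min_le_left _ _)
  have h2 := hz.trans (min_le_right _ _)
  have hpos : 0 < ‖z - c‖ := by linarith [(abs_le.1 h2).1]
  have hne : ((‖z - c‖ : ℝ) : ℂ) ≠ 0 := by exact_mod_cast hpos.ne'
  rw [Metric.mem_thickening_iff]
  -- the radial projection of `z` to the circle
  refine ⟨c + (z - c) / ‖z - c‖, ?_, ?_⟩
  · rw [mem_sphere_iff_norm, add_sub_cancel_left, norm_div, Complex.norm_real, norm_norm,
      div_self hpos.ne']
  · have : z - (c + (z - c) / ‖z - c‖) = (z - c) / ‖z - c‖ * ((‖z - c‖ - 1 : ℝ) : ℂ) := by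
      push_cast
      field_simp
      ring
    rw [dist_eq_norm, this, norm_mul, norm_div, Complex.norm_real, norm_norm, div_self hpos.ne',
      one_mul, Complex.norm_real, Real.norm_eq_abs]
    linarith

/-- Probability measures which concentrate near the circle `|z - c| = 1` and all of whose moments
about `c` of positive order tend to `0` converge to normalized arc length. -/
theorem tendsto_integral_normalizedArcLength {c : ℂ} {ν : ℕ → Measure ℂ}
    (hν : ∀ n, IsProbabilityMeasure (ν n))
    (hcirc : ∀ δ > 0, ∀ᶠ n in atTop, ∀ᵐ z ∂ν n, |‖z - c‖ - 1| ≤ δ)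
    (hmom : ∀ k : ℕ, 1 ≤ k → Tendsto (fun n => ∫ z, (z - c) ^ k ∂ν n) atTop (𝓝 0))
    {f : ℂ → ℂ} (hf : Continuous f) :
    Tendsto (fun n => ∫ z, f z ∂ν n) atTop (𝓝 (∫ z, f z ∂normalizedArcLength c 1)) := by
  have := isProbabilityMeasure_normalizedArcLength c 1
  have hμ : ∀ δ ≥ 0, ∀ᵐ z ∂normalizedArcLength c 1, |‖z - c‖ - 1| ≤ δ := fun δ hδ => by
    filter_upwards [ae_normalizedArcLength (c := c) zero_le_one] with z hz
    rw [mem_sphere_iff_norm.1 hz]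
    simpa using hδ
  have : Fact (0 < 2 * Real.pi) := ⟨by positivity⟩
  rw [Metric.tendsto_nhds]
  intro ε hε
  let F : C(AddCircle (2 * Real.pi), ℂ) := ⟨fun x => f (c + fourier 1 x), by fun_prop⟩
  have hF : F ∈ (Submodule.span ℂ (Set.range <| @fourier (2 * Real.pi))).topologicalClosure := by
    rw [span_fourier_closure_eq_top]
    trivial
  obtain ⟨T, hT, hFT⟩ := Metric.mem_closure_iff.1 hF (ε / 4) (by positivity)
  obtain ⟨g, hg, hgT, hglim⟩ :=
    exists_extension_of_mem_span_fourier hν (hcirc 1 one_pos) hmom hT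
  have hfg : ∀ z, ‖z - c‖ = 1 → ‖f z - g z‖ < ε / 4 := fun z hz => by
    obtain ⟨x, rfl⟩ := exists_fourier_one_eq hz
    rw [hgT, ← dist_eq_norm]
    exact (ContinuousMap.dist_apply_le_dist (f := F) (g := T) x).trans_lt hFT
  obtain ⟨δ, hδ, hδ1, hann⟩ := exists_annulus_norm_sub_lt hf hg hfg
  have key : ∀ ρ : Measure ℂ, IsProbabilityMeasure ρ → (∀ᵐ z ∂ρ, |‖z - c‖ - 1| ≤ δ) →
      ‖(∫ z, f z ∂ρ) - ∫ z, g z ∂ρ‖ ≤ ε / 4 := fun ρ _ hρ => by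
    have h1 : ∀ᵐ z ∂ρ, |‖z - c‖ - 1| ≤ 1 := hρ.mono fun z hz => hz.trans hδ1.le
    rw [← integral_sub (integrable_of_ae_abs_norm_sub_le h1 hf)
      (integrable_of_ae_abs_norm_sub_le h1 hg)]
    refine (norm_integral_le_of_norm_le_const (C := ε / 4) ?_).trans (by simp)
    filter_upwards [hρ] with z hz using (hann z hz).le
  filter_upwards [hcirc δ hδ, Metric.tendsto_nhds.1 hglim (ε / 4) (by positivity)] with n hn hn'
  have h1 := key _ (hν n) hn
  have h2 := key _ (isProbabilityMeasure_normalizedArcLength c 1) (hμ δ hδ.le)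
  rw [dist_eq_norm] at hn' ⊢
  calc ‖(∫ z, f z ∂ν n) - ∫ z, f z ∂normalizedArcLength c 1‖
      = ‖((∫ z, f z ∂ν n) - ∫ z, g z ∂ν n)
          + ((∫ z, g z ∂ν n) - ∫ z, g z ∂normalizedArcLength c 1)
          - ((∫ z, f z ∂normalizedArcLength c 1) - ∫ z, g z ∂normalizedArcLength c 1)‖ := by
        congr 1; ring
    _ ≤ ‖(∫ z, f z ∂ν n) - ∫ z, g z ∂ν n‖
          + ‖(∫ z, g z ∂ν n) - ∫ z, g z ∂normalizedArcLength c 1‖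
          + ‖(∫ z, f z ∂normalizedArcLength c 1) - ∫ z, g z ∂normalizedArcLength c 1‖ :=
        (norm_sub_le _ _).trans (by gcongr; exact norm_add_le _ _)
    _ < ε := by linarith

/-- A probability measure on the circle `|z - c| = 1` with vanishing moments of positive order is
normalized arc length. -/
theorem eq_normalizedArcLength_of_moments {c : ℂ} {ν : Measure ℂ} [IsProbabilityMeasure ν]
    (hcirc : ∀ᵐ z ∂ν, ‖z - c‖ = 1) (hmom : ∀ k : ℕ, 1 ≤ k → ∫ z, (z - c) ^ k ∂ν = 0) :
    ν = normalizedArcLength c 1 := by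
  have := isProbabilityMeasure_normalizedArcLength c 1
  refine ext_of_forall_integral_eq_of_IsFiniteMeasure fun f => ?_
  have h := tendsto_nhds_unique tendsto_const_nhds
    (tendsto_integral_normalizedArcLength (c := c) (ν := fun _ => ν) (fun _ => inferInstance)
      (fun δ hδ => Eventually.of_forall fun _ => hcirc.mono fun z hz => by
        rw [hz]; simpa using hδ.le)
      (fun k hk => by simp only [hmom k hk]; exact tendsto_const_nhds)
      (f := fun z => (f z : ℂ)) (by fun_prop))
  simp only [integral_complex_ofReal] at h
  exact_mod_cast h


/-! ### The logarithmic kernel on the unit disc -/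

theorem logKernel_self (z : ℂ) : logKernel z z = ⊤ := by
  simp [logKernel]

theorem logKernel_of_ne {z w : ℂ} (h : z ≠ w) :
    logKernel z w = ((-Real.log ‖z - w‖ : ℝ) : EReal) := by
  rw [logKernel, ← ofReal_norm, ENNReal.log_ofReal_of_pos (norm_pos_iff.2 (sub_ne_zero.2 h)),
    EReal.coe_neg]

theorem measurable_logKernel : Measurable fun p : ℂ × ℂ => logKernel p.1 p.2 := by
  unfold logKernel
  fun_prop

theorem norm_one_sub_mul_conj_sq (a b : ℂ) :
    ‖1 - a * (starRingEnd ℂ) b‖ ^ 2 = ‖a - b‖ ^ 2 + (1 - ‖a‖ ^ 2) * (1 - ‖b‖ ^ 2) := by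
  simp only [← Complex.normSq_eq_norm_sq, Complex.normSq_apply, Complex.sub_re, Complex.sub_im,
    Complex.mul_re, Complex.mul_im, Complex.conj_re, Complex.conj_im, Complex.one_re,
    Complex.one_im]
  ring

/-- The supremum of `|1 - u| / |1 - r u|` over the unit disc is attained at `u = -1`. -/
theorem one_add_mul_norm_one_sub_le {u : ℂ} (hu : ‖u‖ ≤ 1) {r : ℝ} (hr0 : 0 ≤ r) (hr1 : r ≤ 1) :
    (1 + r) * ‖1 - u‖ ≤ 2 * ‖1 - r * u‖ := by
  refine le_of_sq_le_sq ?_ (by positivity)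
  have hs : u.re ^ 2 + u.im ^ 2 ≤ 1 := by
    have := Complex.normSq_apply u
    rw [Complex.normSq_eq_norm_sq] at this
    nlinarith [norm_nonneg u]
  have hx : -1 ≤ u.re := by nlinarith [sq_nonneg u.im]
  simp only [mul_pow, ← Complex.normSq_eq_norm_sq, Complex.normSq_apply, Complex.sub_re,
    Complex.sub_im, Complex.mul_re, Complex.mul_im, Complex.ofReal_re, Complex.ofReal_im,
    Complex.one_re, Complex.one_im]
  have h1 : 0 ≤ (1 - r) * (1 - r) * (1 + u.re) := by
    have : 0 ≤ 1 + u.re := by linarith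
    positivity
  have h2 : 0 ≤ (1 - r) * (1 + 3 * r) * (1 - (u.re ^ 2 + u.im ^ 2)) :=
    mul_nonneg (mul_nonneg (by linarith) (by linarith)) (by linarith)
  nlinarith [h1, h2]

/-- For `r < 1` a bounded minorant of `log (1 / |a - b|)` on the unit disc: the kernel
`log (1 / |1 - r a b̄|)`, which is positive definite, up to a constant that vanishes as `r → 1`,
plus a product term that detects mass inside the disc. -/
noncomputable def kernelMinorant (r : ℝ) (a b : ℂ) : ℝ :=
  -Real.log ‖1 - r * (a * (starRingEnd ℂ) b)‖ - Real.log (2 / (1 + r)) +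
    (1 - ‖a‖ ^ 2) * (1 - ‖b‖ ^ 2) / 8

theorem kernelMinorant_le {r : ℝ} (hr0 : 0 ≤ r) (hr1 : r < 1) {a b : ℂ} (ha : ‖a‖ ≤ 1)
    (hb : ‖b‖ ≤ 1) (hab : a ≠ b) : kernelMinorant r a b ≤ -Real.log ‖a - b‖ := by
  have hu : ‖a * (starRingEnd ℂ) b‖ ≤ 1 := by
    rw [norm_mul, RCLike.norm_conj]
    exact mul_le_one₀ ha (norm_nonneg _) hb
  have hid := norm_one_sub_mul_conj_sq a b
  have hmob := one_add_mul_norm_one_sub_le hu hr0 hr1.le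
  unfold kernelMinorant
  set u := a * (starRingEnd ℂ) b
  have hB : 0 < ‖a - b‖ := norm_pos_iff.2 (sub_ne_zero.2 hab)
  have hs : 0 ≤ (1 - ‖a‖ ^ 2) * (1 - ‖b‖ ^ 2) := by
    refine mul_nonneg ?_ ?_ <;> nlinarith [norm_nonneg a, norm_nonneg b]
  set s := (1 - ‖a‖ ^ 2) * (1 - ‖b‖ ^ 2)
  have hA2 : 0 < ‖1 - u‖ ^ 2 := by
    rw [hid]
    positivity
  have hA : 0 < ‖1 - u‖ := (norm_nonneg _).lt_of_ne fun h => by rw [← h] at hA2; simp at hA2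
  have hA4 : ‖1 - u‖ ≤ 2 := (norm_sub_le _ _).trans (by rw [norm_one]; linarith)
  -- `log B ≤ log A - s / A` for `A = |1 - a b̄|²`, `B = |a - b|² = A - s`, and `A ≤ 4`
  have h1 : Real.log ‖a - b‖ ≤ Real.log ‖1 - u‖ - s / 8 := by
    have h := Real.log_le_sub_one_of_pos (div_pos (pow_pos hB 2) hA2)
    rw [Real.log_div (by positivity) (by positivity), Real.log_pow, Real.log_pow] at h
    have h' : ‖a - b‖ ^ 2 / ‖1 - u‖ ^ 2 = 1 - s / ‖1 - u‖ ^ 2 := by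
      field_simp
      linarith
    have h'' : s / 4 ≤ s / ‖1 - u‖ ^ 2 :=
      div_le_div_of_nonneg_left hs hA2 (by nlinarith)
    push_cast at h
    linarith
  have h2 : Real.log ‖1 - u‖ ≤ Real.log (2 / (1 + r)) + Real.log ‖1 - r * u‖ := by
    have hpos : 0 < ‖1 - (r : ℂ) * u‖ := by nlinarith
    rw [← Real.log_mul (by positivity) hpos.ne']
    refine Real.log_le_log hA ?_
    rw [div_mul_eq_mul_div, le_div_iff₀ (by positivity)]
    linarith
  linarith

theorem norm_one_sub_mem_Icc {r : ℝ} (hr0 : 0 ≤ r) (hr1 : r < 1) {u : ℂ} (hu : ‖u‖ ≤ 1) :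
    ‖1 - r * u‖ ∈ Set.Icc (1 - r) 2 := by
  have h : ‖(r : ℂ) * u‖ ≤ r := by
    rw [norm_mul, Complex.norm_real, Real.norm_eq_abs, abs_of_nonneg hr0]
    exact mul_le_of_le_one_right hr0 hu
  have h1 := norm_sub_norm_le 1 ((r : ℂ) * u)
  have h2 := norm_sub_le 1 ((r : ℂ) * u)
  rw [norm_one] at h1 h2
  constructor <;> linarith

theorem neg_two_mul_log_two_le_kernelMinorant {r : ℝ} (hr0 : 0 ≤ r) (hr1 : r < 1) {a b : ℂ}
    (ha : ‖a‖ ≤ 1) (hb : ‖b‖ ≤ 1) : -(2 * Real.log 2) ≤ kernelMinorant r a b := by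
  have hu : ‖a * (starRingEnd ℂ) b‖ ≤ 1 := by
    rw [norm_mul, RCLike.norm_conj]
    exact mul_le_one₀ ha (norm_nonneg _) hb
  obtain ⟨h1, h2⟩ := norm_one_sub_mem_Icc hr0 hr1 hu
  have h3 := Real.log_le_log (by linarith) h2
  have h4 : Real.log (2 / (1 + r)) ≤ Real.log 2 :=
    Real.log_le_log (by positivity) (div_le_self (by norm_num) (by linarith))
  have hs : 0 ≤ (1 - ‖a‖ ^ 2) * (1 - ‖b‖ ^ 2) := by
    refine mul_nonneg ?_ ?_ <;> nlinarith [norm_nonneg a, norm_nonneg b]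
  unfold kernelMinorant
  linarith

/-- A bounded lower bound `h` for the logarithmic kernel gives a lower bound for its positive part;
the constant `C` keeps all terms nonnegative, so that the diagonal needs no separate treatment. -/
theorem toENNReal_neg_logKernel_add_le {z w : ℂ} {h C : ℝ} (hC : 0 ≤ C) (hhC : 0 ≤ h + C)
    (hh : z ≠ w → h ≤ -Real.log ‖z - w‖) :
    (-logKernel z w).toENNReal + ENNReal.ofReal (h + C) ≤
      (logKernel z w).toENNReal + ENNReal.ofReal C := by
  rcases eq_or_ne z w with rfl | hzw
  · simp [logKernel_self]
  have hh := hh hzw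
  rw [logKernel_of_ne hzw, ← EReal.coe_neg, EReal.real_coe_toENNReal, EReal.real_coe_toENNReal,
    neg_neg]
  rcases le_total 0 (Real.log ‖z - w‖) with hl | hl
  · rw [ENNReal.ofReal_of_nonpos (p := -_) (by linarith), zero_add,
      ← ENNReal.ofReal_add hl hhC]
    exact ENNReal.ofReal_le_ofReal (by linarith)
  · rw [ENNReal.ofReal_of_nonpos hl, zero_add, ← ENNReal.ofReal_add (by linarith) hC]
    exact ENNReal.ofReal_le_ofReal (by linarith)

/-! ### Energy of measures on a disc -/

theorem ae_prod_norm_sub_le {c : ℂ} {ν : Measure ℂ} [IsProbabilityMeasure ν]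
    (hν : ∀ᵐ z ∂ν, ‖z - c‖ ≤ 1) :
    ∀ᵐ p ∂ν.prod ν, ‖p.1 - c‖ ≤ 1 ∧ ‖p.2 - c‖ ≤ 1 :=
  (Measure.quasiMeasurePreserving_fst.ae hν).and (Measure.quasiMeasurePreserving_snd.ae hν)

theorem integrable_kernelMinorant {c : ℂ} {ν : Measure ℂ} [IsProbabilityMeasure ν]
    (hν : ∀ᵐ z ∂ν, ‖z - c‖ ≤ 1) {r : ℝ} (hr0 : 0 ≤ r) (hr1 : r < 1) :
    Integrable (fun p : ℂ × ℂ => -Real.log ‖1 - r * ((p.1 - c) * (starRingEnd ℂ) (p.2 - c))‖)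
      (ν.prod ν) ∧
    Integrable (fun p : ℂ × ℂ => (1 - ‖p.1 - c‖ ^ 2) * (1 - ‖p.2 - c‖ ^ 2) / 8) (ν.prod ν) := by
  constructor
  · refine Integrable.of_bound (Measurable.aestronglyMeasurable (by fun_prop))
      (max (Real.log 2) (-Real.log (1 - r))) ?_
    filter_upwards [ae_prod_norm_sub_le hν] with p hp
    have hu : ‖(p.1 - c) * (starRingEnd ℂ) (p.2 - c)‖ ≤ 1 := by
      rw [norm_mul, RCLike.norm_conj]
      exact mul_le_one₀ hp.1 (norm_nonneg _) hp.2
    obtain ⟨h1, h2⟩ := norm_one_sub_mem_Icc hr0 hr1 hu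
    have h3 := Real.log_le_log (by linarith) h2
    have h4 := Real.log_le_log (by linarith) h1
    rw [norm_neg, Real.norm_eq_abs, abs_le]
    constructor
    · linarith [le_max_right (Real.log 2) (-Real.log (1 - r))]
    · linarith [le_max_left (Real.log 2) (-Real.log (1 - r))]
  · refine Integrable.of_bound (Measurable.aestronglyMeasurable (by fun_prop)) (1 / 8) ?_
    filter_upwards [ae_prod_norm_sub_le hν] with p hp
    have h1 : ‖p.1 - c‖ ^ 2 ≤ 1 := pow_le_one₀ (norm_nonneg _) hp.1
    have h2 : ‖p.2 - c‖ ^ 2 ≤ 1 := pow_le_one₀ (norm_nonneg _) hp.2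
    have h3 : 0 ≤ (1 - ‖p.1 - c‖ ^ 2) * (1 - ‖p.2 - c‖ ^ 2) :=
      mul_nonneg (by linarith) (by linarith)
    rw [Real.norm_eq_abs, abs_of_nonneg (by positivity)]
    have := mul_le_one₀ (a := 1 - ‖p.1 - c‖ ^ 2) (b := 1 - ‖p.2 - c‖ ^ 2)
      (by nlinarith [norm_nonneg (p.1 - c)]) (by linarith) (by nlinarith [norm_nonneg (p.2 - c)])
    linarith

/-- Expanding `-log (1 - r a b̄)` in powers turns the double integral into the series
`∑ rᵏ |mₖ|² / k` over the moments `mₖ`, so it dominates each of its terms. The term `k = 0` is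
`0` because `1 / 0 = 0`, in agreement with the power series of the logarithm. -/
theorem le_integral_neg_log_norm_one_sub {c : ℂ} {ν : Measure ℂ} [IsProbabilityMeasure ν]
    (hν : ∀ᵐ z ∂ν, ‖z - c‖ ≤ 1) {r : ℝ} (hr0 : 0 ≤ r) (hr1 : r < 1) (k : ℕ) :
    r ^ k / k * ‖∫ z, (z - c) ^ k ∂ν‖ ^ 2 ≤
      ∫ p : ℂ × ℂ, -Real.log ‖1 - r * ((p.1 - c) * (starRingEnd ℂ) (p.2 - c))‖ ∂ν.prod ν := by
  let F : ℕ → ℂ × ℂ → ℂ := fun j p => (r * ((p.1 - c) * (starRingEnd ℂ) (p.2 - c))) ^ j / j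
  have hae : ∀ᵐ p : ℂ × ℂ ∂ν.prod ν, ‖(r : ℂ) * ((p.1 - c) * (starRingEnd ℂ) (p.2 - c))‖ ≤ r := by
    filter_upwards [ae_prod_norm_sub_le hν] with p hp
    rw [norm_mul, norm_mul, RCLike.norm_conj, Complex.norm_real, Real.norm_eq_abs,
      abs_of_nonneg hr0]
    exact mul_le_of_le_one_right hr0 (mul_le_one₀ hp.1 (norm_nonneg _) hp.2)
  have hbound : ∀ j, ∀ᵐ p ∂ν.prod ν, ‖F j p‖ ≤ r ^ j := fun j => by
    filter_upwards [hae] with p hp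
    simp only [F]
    rw [norm_div, norm_pow, Complex.norm_natCast]
    rcases Nat.eq_zero_or_pos j with rfl | hj
    · simp
    · refine (div_le_self (by positivity) (by exact_mod_cast hj)).trans ?_
      exact pow_le_pow_left₀ (norm_nonneg _) hp j
  have hint : ∀ j, Integrable (F j) (ν.prod ν) := fun j =>
    Integrable.of_bound (Measurable.aestronglyMeasurable (by fun_prop)) (r ^ j) (hbound j)
  have hsummable : Summable fun j => ∫ p, ‖F j p‖ ∂ν.prod ν := by
    refine Summable.of_nonneg_of_le (fun j => integral_nonneg fun p => norm_nonneg _) (fun j => ?_)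
      (summable_geometric_of_lt_one hr0 hr1)
    refine (integral_mono_ae (hint j).norm (integrable_const _) (hbound j)).trans ?_
    simp
  have hsum := hasSum_integral_of_summable_integral_norm hint hsummable
  have hlog : ∫ p, ∑' j, F j p ∂ν.prod ν =
      ∫ p : ℂ × ℂ, -Complex.log (1 - r * ((p.1 - c) * (starRingEnd ℂ) (p.2 - c))) ∂ν.prod ν := by
    refine integral_congr_ae ?_
    filter_upwards [hae] with p hp
    exact (Complex.hasSum_taylorSeries_neg_log (hp.trans_lt hr1)).tsum_eq
  have hlogint : Integrable (fun p : ℂ × ℂ =>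
      -Complex.log (1 - r * ((p.1 - c) * (starRingEnd ℂ) (p.2 - c)))) (ν.prod ν) := by
    refine Integrable.of_bound (Measurable.aestronglyMeasurable (by fun_prop)) (∑' j : ℕ, r ^ j) ?_
    have hb : ∀ᵐ p ∂ν.prod ν, ∀ j, ‖F j p‖ ≤ r ^ j := ae_all_iff.2 hbound
    filter_upwards [hae, hb] with p hp hpb
    rw [← (Complex.hasSum_taylorSeries_neg_log (hp.trans_lt hr1)).tsum_eq]
    exact tsum_of_norm_bounded (summable_geometric_of_lt_one hr0 hr1).hasSum hpb
  have hterm : ∀ j, ∫ p, F j p ∂ν.prod ν =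
      ((r ^ j / j * ‖∫ z, (z - c) ^ j ∂ν‖ ^ 2 : ℝ) : ℂ) := fun j => by
    have h1 : ∀ p, F j p = (r : ℂ) ^ j / j *
        ((p.1 - c) ^ j * (starRingEnd ℂ) ((p.2 - c) ^ j)) := fun p => by
      simp only [F, mul_pow, map_pow]
      ring
    simp only [h1]
    rw [integral_const_mul, integral_prod_mul (fun z : ℂ => (z - c) ^ j)
      (fun z : ℂ => (starRingEnd ℂ) ((z - c) ^ j)), integral_conj, Complex.mul_conj,
      Complex.normSq_eq_norm_sq]
    push_cast
    rfl
  rw [hlog] at hsum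
  simp only [hterm] at hsum
  have hre := Complex.hasSum_re hsum
  simp only [Complex.ofReal_re] at hre
  refine (le_hasSum hre k fun j _ => by positivity).trans_eq ?_
  have := integral_re hlogint
  simp only [RCLike.re_eq_complex_re] at this
  rw [← this]
  simp [Complex.log_re]

theorem le_integral_kernelMinorant {c : ℂ} {ν : Measure ℂ} [IsProbabilityMeasure ν]
    (hν : ∀ᵐ z ∂ν, ‖z - c‖ ≤ 1) {r : ℝ} (hr0 : 0 ≤ r) (hr1 : r < 1) (k : ℕ) :
    r ^ k / k * ‖∫ z, (z - c) ^ k ∂ν‖ ^ 2 - Real.log (2 / (1 + r)) +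
        (∫ z, (1 - ‖z - c‖ ^ 2) ∂ν) ^ 2 / 8 ≤
      ∫ p : ℂ × ℂ, kernelMinorant r (p.1 - c) (p.2 - c) ∂ν.prod ν := by
  obtain ⟨h1, h2⟩ := integrable_kernelMinorant hν hr0 hr1
  have h3 : Integrable (fun p : ℂ × ℂ =>
      -Real.log ‖1 - r * ((p.1 - c) * (starRingEnd ℂ) (p.2 - c))‖ - Real.log (2 / (1 + r)))
      (ν.prod ν) := h1.sub (integrable_const _)
  unfold kernelMinorant
  rw [integral_add h3 h2, integral_sub h1 (integrable_const _),
    integral_div, integral_prod_mul (fun z : ℂ => 1 - ‖z - c‖ ^ 2) (fun z : ℂ => 1 - ‖z - c‖ ^ 2)]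
  have := le_integral_neg_log_norm_one_sub hν hr0 hr1 k
  simp only [integral_const, probReal_univ, one_smul]
  rw [pow_two (∫ z, (1 - ‖z - c‖ ^ 2) ∂ν)]
  linarith

theorem logEnergy_pos_of_integral_kernelMinorant_pos {c : ℂ} {ν : Measure ℂ}
    [IsProbabilityMeasure ν] (hν : ∀ᵐ z ∂ν, ‖z - c‖ ≤ 1) {r : ℝ} (hr0 : 0 ≤ r) (hr1 : r < 1)
    (hpos : 0 < ∫ p : ℂ × ℂ, kernelMinorant r (p.1 - c) (p.2 - c) ∂ν.prod ν) :
    0 < logEnergy ν := by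
  obtain ⟨hi1, hi2⟩ := integrable_kernelMinorant hν hr0 hr1
  have hint : Integrable (fun p : ℂ × ℂ => kernelMinorant r (p.1 - c) (p.2 - c)) (ν.prod ν) :=
    (hi1.sub (integrable_const _)).add hi2
  have hintC : Integrable (fun p : ℂ × ℂ =>
      kernelMinorant r (p.1 - c) (p.2 - c) + 2 * Real.log 2) (ν.prod ν) :=
    hint.add (integrable_const _)
  have hlog2 : 0 ≤ Real.log 2 := Real.log_nonneg (by norm_num)
  set C := 2 * Real.log 2 with hC
  have hC0 : 0 ≤ C := by positivity
  have hm : Measurable fun p : ℂ × ℂ => (logKernel p.1 p.2).toENNReal :=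
    measurable_logKernel.ereal_toENNReal
  have hm' : Measurable fun p : ℂ × ℂ => (-logKernel p.1 p.2).toENNReal :=
    measurable_logKernel.neg.ereal_toENNReal
  have hle : ∫⁻ p : ℂ × ℂ, ((-logKernel p.1 p.2).toENNReal +
      ENNReal.ofReal (kernelMinorant r (p.1 - c) (p.2 - c) + C)) ∂ν.prod ν ≤
      ∫⁻ p : ℂ × ℂ, ((logKernel p.1 p.2).toENNReal + ENNReal.ofReal C) ∂ν.prod ν := by
    refine lintegral_mono_ae ?_
    filter_upwards [ae_prod_norm_sub_le hν] with p hp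
    refine toENNReal_neg_logKernel_add_le hC0
      (by linarith [neg_two_mul_log_two_le_kernelMinorant hr0 hr1 hp.1 hp.2]) fun hne => ?_
    have := kernelMinorant_le hr0 hr1 hp.1 hp.2 (by simpa using hne)
    rwa [sub_sub_sub_cancel_right] at this
  rw [lintegral_add_left hm', lintegral_add_left hm, lintegral_const, measure_univ, mul_one,
    ← ofReal_integral_eq_lintegral_ofReal hintC (by
      filter_upwards [ae_prod_norm_sub_le hν] with p hp
      have := neg_two_mul_log_two_le_kernelMinorant hr0 hr1 hp.1 hp.2
      simp only [Pi.zero_apply]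
      linarith)] at hle
  have hval : ∫ p : ℂ × ℂ, (kernelMinorant r (p.1 - c) (p.2 - c) + C) ∂ν.prod ν =
      (∫ p : ℂ × ℂ, kernelMinorant r (p.1 - c) (p.2 - c) ∂ν.prod ν) + C := by
    rw [integral_add hint (integrable_const _)]
    simp
  rw [hval, ENNReal.ofReal_add hpos.le hC0, ← add_assoc] at hle
  have hle' := (ENNReal.add_le_add_iff_right ENNReal.ofReal_ne_top).1 hle
  have hfin : ∫⁻ p : ℂ × ℂ, (-logKernel p.1 p.2).toENNReal ∂ν.prod ν ≠ ⊤ := by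
    have : ∫⁻ p : ℂ × ℂ, (-logKernel p.1 p.2).toENNReal ∂ν.prod ν ≤
        ∫⁻ _ : ℂ × ℂ, ENNReal.ofReal (Real.log 2) ∂ν.prod ν := by
      refine lintegral_mono_ae ?_
      filter_upwards [ae_prod_norm_sub_le hν] with p hp
      rcases eq_or_ne p.1 p.2 with h | h
      · rw [h, logKernel_self]
        simp
      rw [logKernel_of_ne h, ← EReal.coe_neg, neg_neg, EReal.real_coe_toENNReal]
      refine ENNReal.ofReal_le_ofReal (Real.log_le_log (norm_pos_iff.2 (sub_ne_zero.2 h)) ?_)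
      rw [← sub_sub_sub_cancel_right p.1 p.2 c]
      exact (norm_sub_le _ _).trans (by linarith [hp.1, hp.2])
    refine (this.trans_lt ?_).ne
    simp
  rw [logEnergy, EReal.sub_pos, EReal.coe_ennreal_lt_coe_ennreal_iff]
  have e1 := lintegral_prod (μ := ν) (ν := ν) _ hm.aemeasurable
  have e2 := lintegral_prod (μ := ν) (ν := ν) _ hm'.aemeasurable
  simp only at e1 e2
  rw [← e1, ← e2]
  exact (ENNReal.lt_add_right hfin (by simpa using hpos)).trans_le hle'

/-- A probability measure on the disc `|z - c| ≤ 1` other than normalized arc length has positive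
energy: either one of its moments is nonzero or it charges the open disc. -/
theorem logEnergy_pos {c : ℂ} {ν : Measure ℂ} [IsProbabilityMeasure ν]
    (hν : ∀ᵐ z ∂ν, ‖z - c‖ ≤ 1) (hne : ν ≠ normalizedArcLength c 1) : 0 < logEnergy ν := by
  have hpos : ∃ k : ℕ, 0 < (1 : ℝ) ^ k / k * ‖∫ z, (z - c) ^ k ∂ν‖ ^ 2 - Real.log (2 / (1 + 1)) +
        (∫ z, (1 - ‖z - c‖ ^ 2) ∂ν) ^ 2 / 8 := by
    by_contra! hcon
    have hlog : Real.log (2 / (1 + 1)) = 0 := by norm_num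
    rw [hlog] at hcon
    refine hne (eq_normalizedArcLength_of_moments ?_ fun k hk => ?_)
    · have h0 : ∫ z, (1 - ‖z - c‖ ^ 2) ∂ν = 0 := by
        -- for `k = 0` the moment term carries the factor `1 / 0 = 0` and drops out
        have := hcon 0
        simp only [CharP.cast_eq_zero, div_zero, zero_mul, sub_zero, zero_add] at this
        nlinarith [sq_nonneg (∫ z, (1 - ‖z - c‖ ^ 2) ∂ν)]
      have hnonneg : 0 ≤ᵐ[ν] fun z => 1 - ‖z - c‖ ^ 2 := by
        filter_upwards [hν] with z hz
        have := pow_le_one₀ (n := 2) (norm_nonneg _) hz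
        simpa using this
      have hint : Integrable (fun z => 1 - ‖z - c‖ ^ 2) ν := by
        refine integrable_of_ae_abs_norm_sub_le (c := c) ?_ (by fun_prop)
        filter_upwards [hν] with z hz
        rw [abs_le]
        constructor <;> linarith [norm_nonneg (z - c)]
      filter_upwards [(integral_eq_zero_iff_of_nonneg_ae hnonneg hint).1 h0] with z hz
      have hz : 1 - ‖z - c‖ ^ 2 = 0 := hz
      nlinarith [norm_nonneg (z - c)]
    · have h1 := hcon k
      have hk' : (0 : ℝ) < k := by exact_mod_cast hk
      have h2 : (1 : ℝ) ^ k / k * ‖∫ z, (z - c) ^ k ∂ν‖ ^ 2 ≤ 0 := by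
        nlinarith [sq_nonneg (∫ z, (1 - ‖z - c‖ ^ 2) ∂ν)]
      by_contra hm
      have : 0 < ‖∫ z, (z - c) ^ k ∂ν‖ := norm_pos_iff.2 hm
      have : 0 < (1 : ℝ) ^ k / k * ‖∫ z, (z - c) ^ k ∂ν‖ ^ 2 := by positivity
      linarith
  obtain ⟨k, hk⟩ := hpos
  have hcont : ContinuousAt (fun r : ℝ => r ^ k / k * ‖∫ z, (z - c) ^ k ∂ν‖ ^ 2 -
      Real.log (2 / (1 + r)) + (∫ z, (1 - ‖z - c‖ ^ 2) ∂ν) ^ 2 / 8) 1 := by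
    have : ContinuousAt (fun r : ℝ => Real.log (2 / (1 + r))) 1 :=
      ContinuousAt.log (ContinuousAt.div (by fun_prop) (by fun_prop) (by norm_num)) (by norm_num)
    fun_prop
  have hev := (hcont.eventually (lt_mem_nhds hk)).filter_mono
    (nhdsWithin_le_nhds (s := Set.Iio (1 : ℝ)))
  have hev' : ∀ᶠ r in 𝓝[<] (1 : ℝ), r ∈ Set.Ioo (0 : ℝ) 1 := Ioo_mem_nhdsLT one_pos
  obtain ⟨r, hr, hr'⟩ := (hev.and hev').exists
  exact logEnergy_pos_of_integral_kernelMinorant_pos hν hr'.1.le hr'.2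
    (hr.trans_le (le_integral_kernelMinorant hν hr'.1.le hr'.2 k))

/-! ### Arc length as an equilibrium measure -/

theorem ae_normalizedArcLength_ne {c : ℂ} {R : ℝ} (hR : R ≠ 0) (z : ℂ) :
    ∀ᵐ w ∂normalizedArcLength c R, w ≠ z := by
  refine Measure.ae_smul_measure ?_ _
  refine (ae_map_iff (p := fun w => w ≠ z) (continuous_circleMap c R).aemeasurable
    (measurableSet_singleton z).compl).2 (ae_restrict_of_ae ?_)
  have := (Set.Countable.preimage_circleMap (Set.countable_singleton z) c hR).ae_notMem volume
  filter_upwards [this] with θ hθ using hθ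

theorem integrable_log_norm_sub_normalizedArcLength (c z : ℂ) (R : ℝ) :
    Integrable (fun w => Real.log ‖w - z‖) (normalizedArcLength c R) := by
  refine Integrable.smul_measure ?_ (by simp [Real.pi_pos])
  rw [integrable_map_measure (Measurable.aestronglyMeasurable (by fun_prop))
    (continuous_circleMap c R).aemeasurable]
  have h := circleIntegrable_log_norm_sub_const (a := z) (c := c) R
  exact (intervalIntegrable_iff_integrableOn_Ioc_of_le (by positivity)).1 h

/-- The logarithmic potential of normalized arc length vanishes on the disc `|z - c| ≤ 1`. -/
theorem lintegral_logKernel_normalizedArcLength {c z : ℂ} (hz : z ∈ Metric.closedBall c 1) :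
    ∫⁻ w, (logKernel z w).toENNReal ∂normalizedArcLength c 1 =
      ∫⁻ w, (-logKernel z w).toENNReal ∂normalizedArcLength c 1 ∧
    ∫⁻ w, (-logKernel z w).toENNReal ∂normalizedArcLength c 1 ≤ ENNReal.ofReal (Real.log 2) := by
  have := isProbabilityMeasure_normalizedArcLength c 1
  have hne := ae_normalizedArcLength_ne (c := c) one_ne_zero z
  have hint := integrable_log_norm_sub_normalizedArcLength c z 1
  have h1 : ∫⁻ w, (logKernel z w).toENNReal ∂normalizedArcLength c 1 =
      ∫⁻ w, ENNReal.ofReal (-Real.log ‖w - z‖) ∂normalizedArcLength c 1 := by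
    refine lintegral_congr_ae ?_
    filter_upwards [hne] with w hw
    rw [logKernel_of_ne hw.symm, EReal.real_coe_toENNReal, norm_sub_rev]
  have h2 : ∫⁻ w, (-logKernel z w).toENNReal ∂normalizedArcLength c 1 =
      ∫⁻ w, ENNReal.ofReal (Real.log ‖w - z‖) ∂normalizedArcLength c 1 := by
    refine lintegral_congr_ae ?_
    filter_upwards [hne] with w hw
    rw [logKernel_of_ne hw.symm, ← EReal.coe_neg, neg_neg, EReal.real_coe_toENNReal, norm_sub_rev]
  rw [h1, h2]
  constructor
  · have h0 : ∫ w, Real.log ‖w - z‖ ∂normalizedArcLength c 1 = 0 := by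
      rw [integral_normalizedArcLength (Measurable.stronglyMeasurable (by fun_prop)),
        circleAverage_log_norm_sub_const_of_mem_closedBall (by simpa using hz), Real.log_one]
    rw [integral_eq_lintegral_pos_part_sub_lintegral_neg_part hint, sub_eq_zero] at h0
    have hfin : ∀ {g : ℂ → ℝ}, Integrable g (normalizedArcLength c 1) →
        ∫⁻ w, ENNReal.ofReal (g w) ∂normalizedArcLength c 1 ≠ ⊤ := fun hg => hg.lintegral_lt_top.ne
    exact ((ENNReal.toReal_eq_toReal_iff' (hfin hint) (hfin hint.neg)).1 h0).symm
  · refine (lintegral_mono_ae (g := fun _ => ENNReal.ofReal (Real.log 2)) ?_).trans (by simp)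
    filter_upwards [hne, ae_normalizedArcLength (c := c) zero_le_one] with w hw hwc
    refine ENNReal.ofReal_le_ofReal (Real.log_le_log (norm_pos_iff.2 (sub_ne_zero.2 hw)) ?_)
    rw [← sub_sub_sub_cancel_right w z c]
    rw [mem_closedBall_iff_norm] at hz
    rw [mem_sphere_iff_norm] at hwc
    exact (norm_sub_le _ _).trans (by linarith)

theorem logEnergy_normalizedArcLength (c : ℂ) : logEnergy (normalizedArcLength c 1) = 0 := by
  have := isProbabilityMeasure_normalizedArcLength c 1
  have hae : ∀ᵐ z ∂normalizedArcLength c 1, z ∈ Metric.closedBall c 1 :=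
    (ae_normalizedArcLength zero_le_one).mono fun z hz => Metric.sphere_subset_closedBall hz
  rw [logEnergy, lintegral_congr_ae (hae.mono fun z hz =>
    (lintegral_logKernel_normalizedArcLength hz).1)]
  have hle := lintegral_mono_ae (hae.mono fun z hz =>
    (lintegral_logKernel_normalizedArcLength hz).2)
  rw [lintegral_const, measure_univ, mul_one] at hle
  refine EReal.sub_self ?_ ?_
  · simpa using (hle.trans_lt ENNReal.ofReal_lt_top).ne
  · simp

/-- Normalized arc length on `|z - c| = 1` is the equilibrium measure of every set between that
circle and the disc it bounds. -/
theorem isEquilibriumMeasure_normalizedArcLength {c : ℂ} {K : Set ℂ}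
    (hK : Metric.sphere c 1 ⊆ K) (hK' : K ⊆ Metric.closedBall c 1) :
    IsEquilibriumMeasure K (normalizedArcLength c 1) where
  isProbabilityMeasure := isProbabilityMeasure_normalizedArcLength c 1
  carried := (ae_normalizedArcLength zero_le_one).mono fun _ hz => hK hz
  energy_lt ν _ hν hne := by
    rw [logEnergy_normalizedArcLength]
    have hae : ∀ᵐ z ∂ν, z ∈ K := hν
    exact logEnergy_pos (hae.mono fun z hz => mem_closedBall_iff_norm.1 (hK' hz)) hne


/-! ### The truncated binomial expansion -/

/-- The terms of degree less than `m` in the binomial expansion of `(X + 1) ^ (n + m)`. -/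
noncomputable def lowPart (n m : ℕ) : ℂ[X] :=
  ∑ j ∈ Finset.range m, C ((Nat.choose (n + m) j : ℕ) : ℂ) * X ^ j

theorem X_pow_mul_Q (n m : ℕ) : X ^ m * Q n m = (X + 1) ^ (n + m) - lowPart n m := by
  have h : (X + 1 : ℂ[X]) ^ (n + m) =
      ∑ j ∈ Finset.range (m + (n + 1)), X ^ j * 1 ^ (n + m - j) * ((n + m).choose j : ℂ[X]) := by
    rw [add_pow, show n + m + 1 = m + (n + 1) by ring]
  rw [eq_sub_iff_add_eq', h, Finset.sum_range_add, lowPart, Q, Finset.mul_sum]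
  congr 1
  · exact Finset.sum_congr rfl fun j _ => by simp [mul_comm]
  · refine Finset.sum_congr rfl fun j _ => ?_
    rw [add_comm m j]
    simp only [one_pow, mul_one, map_natCast, pow_add]
    ring

theorem degree_lowPart_lt (n m : ℕ) : (lowPart n m).degree < m := by
  refine (degree_sum_le _ _).trans_lt ((Finset.sup_lt_iff (WithBot.bot_lt_coe m)).2 fun j hj => ?_)
  exact (degree_C_mul_X_pow_le _ _).trans_lt (Nat.cast_lt.2 (Finset.mem_range.1 hj))

theorem eval_Q_mul_pow (n m : ℕ) (z : ℂ) :
    z ^ m * (Q n m).eval z = (z + 1) ^ (n + m) - (lowPart n m).eval z := by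
  simpa using congrArg (eval z) (X_pow_mul_Q n m)

theorem monic_X_pow_mul_Q (n m : ℕ) :
    (X ^ m * Q n m).Monic ∧ (X ^ m * Q n m).natDegree = n + m := by
  have h1 : ((X + 1 : ℂ[X]) ^ (n + m)).Monic := by
    simpa using (monic_X_add_C (1 : ℂ)).pow (n + m)
  have h2 : ((X + 1 : ℂ[X]) ^ (n + m)).natDegree = n + m := by
    rw [natDegree_pow, ← C_1, natDegree_X_add_C, mul_one]
  have hlt : (lowPart n m).degree < ((X + 1 : ℂ[X]) ^ (n + m)).degree := by
    rw [degree_eq_natDegree h1.ne_zero, h2]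
    exact (degree_lowPart_lt n m).trans_le (by exact_mod_cast Nat.le_add_left m n)
  rw [X_pow_mul_Q]
  refine ⟨h1.sub_of_left hlt, ?_⟩
  rw [natDegree_eq_of_degree_eq (degree_sub_eq_left_of_degree_lt hlt), h2]

theorem monic_Q (n m : ℕ) : (Q n m).Monic :=
  (monic_X_pow m).of_mul_monic_left (monic_X_pow_mul_Q n m).1

theorem natDegree_Q (n m : ℕ) : (Q n m).natDegree = n := by
  have h := (monic_X_pow_mul_Q n m).2
  rw [(monic_X_pow m).natDegree_mul (monic_Q n m), natDegree_X_pow] at h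
  omega

/-! ### Power sums of the zeros -/

/-- By Newton's identities, power sums vanish as long as the elementary symmetric functions do. -/
theorem sum_map_pow_eq_zero_of_esymm {R : Type*} [CommRing R] {s : Multiset R} {n : ℕ}
    (hs : ∀ i, 1 ≤ i → i ≤ n → s.esymm i = 0) {k : ℕ} (hk : 1 ≤ k) (hkn : k ≤ n) :
    (s.map (· ^ k)).sum = 0 := by
  obtain ⟨N, f, rfl⟩ : ∃ (N : ℕ) (f : Fin N → R), s = Finset.univ.val.map f :=
    ⟨s.toList.length, s.toList.get, by
      rw [Fin.univ_val_map, List.ofFn_get, Multiset.coe_toList]⟩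
  have h := congrArg (MvPolynomial.aeval f) (MvPolynomial.psum_eq_mul_esymm_sub_sum (Fin N) R k hk)
  have hpsum : MvPolynomial.aeval f (MvPolynomial.psum (Fin N) R k) =
      ((Finset.univ.val.map f).map (· ^ k)).sum := by
    simp [MvPolynomial.psum, List.sum_ofFn]
  rw [← hpsum, h, map_sub, map_mul, MvPolynomial.aeval_esymm_eq_multiset_esymm, hs k hk hkn,
    mul_zero, zero_sub, neg_eq_zero, map_sum]
  refine Finset.sum_eq_zero fun a ha => ?_
  have ha' := (Finset.mem_filter.1 ha).2
  rw [map_mul, map_mul, MvPolynomial.aeval_esymm_eq_multiset_esymm,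
    hs a.1 ha'.1 (ha'.2.le.trans hkn), mul_zero, zero_mul]

/-- In the variable `w = z + 1` the polynomial `z ^ m * Q n m z` is `w ^ (n + m)` up to terms of
degree less than `m`, so the power sums of its zeros of orders `1, …, n` vanish. The zero `w = 1`
of multiplicity `m` accounts for the value `-m`. -/
theorem sum_roots_Q_add_one_pow {n m k : ℕ} (hk : 1 ≤ k) (hkn : k ≤ n) :
    ((Q n m).roots.map fun ζ => (ζ + 1) ^ k).sum = -(m : ℂ) := by
  obtain ⟨hmonic, hdeg⟩ := monic_X_pow_mul_Q n m
  have hcard : Multiset.card (X ^ m * Q n m).roots = n + m := by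
    rw [splits_iff_card_roots.1 (IsAlgClosed.splits _), hdeg]
  set s := (X ^ m * Q n m).roots.map fun ζ => ζ + 1 with hs
  have hscard : Multiset.card s = n + m := by rw [hs, Multiset.card_map, hcard]
  have hprod : (s.map fun t => X - C t).prod = X ^ (n + m) - (lowPart n m).comp (X - 1) := by
    have h1 := prod_multiset_X_sub_C_of_monic_of_roots_card_eq hmonic (hcard.trans hdeg.symm)
    have h2 := congrArg (fun p : ℂ[X] => p.comp (X - 1)) h1
    simp only [multiset_prod_comp, Multiset.map_map] at h2
    rw [X_pow_mul_Q, sub_comp, pow_comp, add_comp, X_comp, one_comp, sub_add_cancel] at h2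
    rw [← h2, hs, Multiset.map_map, X_pow_mul_Q]
    congr 1
    refine Multiset.map_congr rfl fun ζ _ => ?_
    simp
    ring
  have hesymm : ∀ i, 1 ≤ i → i ≤ n → s.esymm i = 0 := fun i hi hin => by
    have h1 := Multiset.prod_X_sub_C_coeff s (k := n + m - i) (by omega)
    have h2 : ((lowPart n m).comp (X - 1)).coeff (n + m - i) = 0 := by
      refine coeff_eq_zero_of_degree_lt ?_
      have h3 : ((lowPart n m).comp (X - 1)).natDegree = (lowPart n m).natDegree := by
        rw [natDegree_comp, ← C_1, natDegree_X_sub_C, mul_one]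
      rcases eq_or_ne (lowPart n m) 0 with h0 | h0
      · rw [h0, zero_comp, degree_zero]
        exact WithBot.bot_lt_coe _
      · have h4 := (natDegree_lt_iff_degree_lt h0).2 (degree_lowPart_lt n m)
        refine degree_le_natDegree.trans_lt ?_
        rw [h3]
        exact_mod_cast (by omega : (lowPart n m).natDegree < n + m - i)
    rw [hprod, coeff_sub, h2, coeff_X_pow, if_neg (by omega), sub_zero, hscard,
      show n + m - (n + m - i) = i by omega] at h1
    exact (mul_eq_zero.1 h1.symm).resolve_left (by simp)
  have h := sum_map_pow_eq_zero_of_esymm hesymm hk hkn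
  rw [hs, Multiset.map_map, roots_mul hmonic.ne_zero, roots_X_pow, Multiset.map_add,
    Multiset.sum_add, Multiset.map_nsmul, Multiset.sum_nsmul] at h
  simp only [Function.comp_apply, Multiset.map_singleton, Multiset.sum_singleton, zero_add,
    one_pow, nsmul_eq_mul, mul_one] at h
  exact eq_neg_of_add_eq_zero_right h

/-! ### Asymptotics outside the disc -/

theorem norm_eval_lowPart_le (n m : ℕ) {z : ℂ} (hz : 1 ≤ ‖z + 1‖) :
    ‖(lowPart n m).eval z‖ ≤ m * (2 * (n + m : ℕ)) ^ m * ‖z + 1‖ ^ m := by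
  have hz2 : ‖z‖ ≤ 2 * ‖z + 1‖ := by
    have := norm_sub_le (z + 1) 1
    rw [add_sub_cancel_right, norm_one] at this
    linarith
  rw [lowPart, eval_finsetSum]
  have hterm : ∀ j ∈ Finset.range m, ‖(C ((Nat.choose (n + m) j : ℕ) : ℂ) * X ^ j).eval z‖ ≤
      (2 * (n + m : ℕ)) ^ m * ‖z + 1‖ ^ m := fun j hj => by
    have hj := Finset.mem_range.1 hj
    have h1 : ((n + m).choose j : ℝ) ≤ ((n + m : ℕ) : ℝ) ^ m := by
      have : (n + m).choose j ≤ (n + m) ^ m :=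
        (Nat.choose_le_pow _ _).trans (Nat.pow_le_pow_right (by omega) hj.le)
      exact_mod_cast this
    have h2 : ‖z‖ ^ j ≤ (2 * ‖z + 1‖) ^ m :=
      (pow_le_pow_left₀ (norm_nonneg _) hz2 j).trans
        (pow_le_pow_right₀ (by linarith) hj.le)
    rw [eval_mul, eval_C, eval_pow, eval_X, norm_mul, norm_pow, Complex.norm_natCast]
    calc ((n + m).choose j : ℝ) * ‖z‖ ^ j ≤ ((n + m : ℕ) : ℝ) ^ m * (2 * ‖z + 1‖) ^ m := by gcongr
      _ = (2 * (n + m : ℕ)) ^ m * ‖z + 1‖ ^ m := by rw [mul_pow, mul_pow]; ring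
  refine (norm_sum_le_of_le _ hterm).trans_eq ?_
  rw [Finset.sum_const, Finset.card_range, nsmul_eq_mul, mul_assoc]

theorem tendsto_lowPart_bound (m : ℕ) {q : ℝ} (hq : 1 < q) :
    Tendsto (fun n : ℕ => m * (2 * ((n + m : ℕ) : ℝ)) ^ m / q ^ n) atTop (𝓝 0) := by
  have h := (tendsto_pow_const_div_const_pow_of_one_lt m hq).comp (tendsto_add_atTop_nat m)
  have h2 := h.const_mul (m * 2 ^ m * q ^ m)
  rw [mul_zero] at h2
  refine h2.congr fun n => ?_
  have : q ≠ 0 := by positivity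
  simp only [Function.comp_apply, mul_pow, pow_add]
  field_simp

theorem asympOnCompacts_Q_outside (m : ℕ) :
    AsympOnCompacts (fun n z => (Q n m).eval z / (n : ℂ) ^ (m - 1))
      (fun n z => (z + 1) ^ (n + m) / ((n : ℂ) ^ (m - 1) * z ^ m)) {z : ℂ | 1 < ‖z + 1‖} := by
  refine ⟨fun n z => -((lowPart n m).eval z / (z + 1) ^ (n + m)), fun n hn z hz => ?_,
    fun K hK hKc => ?_⟩
  · have hz : 1 < ‖z + 1‖ := hz
    have hz0 : z ≠ 0 := by
      rintro rfl
      simp at hz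
    have hw0 : z + 1 ≠ 0 := norm_pos_iff.1 (by linarith)
    have hn0 : (n : ℂ) ≠ 0 := by exact_mod_cast (by omega : n ≠ 0)
    have h := eval_Q_mul_pow n m z
    field_simp
    linear_combination h
  · rcases K.eq_empty_or_nonempty with rfl | hne
    · exact tendstoUniformlyOn_empty
    obtain ⟨z₀, hz₀, hmin⟩ := hKc.exists_isMinOn hne (f := fun z : ℂ => ‖z + 1‖) (by fun_prop)
    have hq : 1 < ‖z₀ + 1‖ := hK hz₀
    rw [Metric.tendstoUniformlyOn_iff]
    intro ε hε
    filter_upwards [(tendsto_lowPart_bound m hq).eventually (gt_mem_nhds hε)] with n hn z hz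
    have hzq : ‖z₀ + 1‖ ≤ ‖z + 1‖ := hmin hz
    have hz1 : 1 < ‖z + 1‖ := hq.trans_le hzq
    rw [dist_zero_left, norm_neg, norm_div, norm_pow]
    refine lt_of_le_of_lt ?_ hn
    calc ‖(lowPart n m).eval z‖ / ‖z + 1‖ ^ (n + m)
        ≤ m * (2 * (n + m : ℕ)) ^ m * ‖z + 1‖ ^ m / ‖z + 1‖ ^ (n + m) := by
          gcongr
          exact norm_eval_lowPart_le n m hz1.le
      _ = m * (2 * (n + m : ℕ)) ^ m / ‖z + 1‖ ^ n := by
          rw [pow_add]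
          field_simp
      _ ≤ m * (2 * (n + m : ℕ)) ^ m / ‖z₀ + 1‖ ^ n := by gcongr

/-! ### Asymptotics inside the disc -/

theorem tendsto_choose_add_div_pow (m j : ℕ) :
    Tendsto (fun n : ℕ => ((n + m).choose j : ℝ) / (n : ℝ) ^ j) atTop (𝓝 (1 / j.factorial)) := by
  have h1 : Tendsto (fun n : ℕ => (n.choose j : ℝ) / ((n : ℝ) ^ j / j.factorial)) atTop (𝓝 1) := by
    refine (Asymptotics.isEquivalent_iff_tendsto_one ?_).1 (isEquivalent_choose j)
    filter_upwards [eventually_ge_atTop 1] with n hn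
    have : (0 : ℝ) < n := by exact_mod_cast hn
    positivity
  have h2 := h1.comp (tendsto_add_atTop_nat m)
  have h3 : Tendsto (fun n : ℕ => ((n : ℝ) / (n + m)) ^ j) atTop (𝓝 (1 ^ j)) :=
    (tendsto_natCast_div_add_atTop (m : ℝ)).pow j
  have h4 := (h2.div h3 (by simp)).const_mul (1 / (j.factorial : ℝ))
  simp only [one_pow, div_one, mul_one] at h4
  refine h4.congr' ?_
  filter_upwards [eventually_ge_atTop 1] with n hn
  have : (0 : ℝ) < n := by exact_mod_cast hn
  simp only [Pi.div_apply, Function.comp_apply, div_pow]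
  push_cast
  field_simp

theorem tendsto_choose_add_div_pow_of_lt (m : ℕ) {j p : ℕ} (hj : j < p) :
    Tendsto (fun n : ℕ => ((n + m).choose j : ℝ) / (n : ℝ) ^ p) atTop (𝓝 0) := by
  have h1 := (tendsto_pow_div_pow_atTop_zero (𝕜 := ℝ) hj).comp tendsto_natCast_atTop_atTop
  have h2 := (tendsto_choose_add_div_pow m j).mul h1
  rw [mul_zero] at h2
  refine h2.congr' ?_
  filter_upwards [eventually_ge_atTop 1] with n hn
  have : (0 : ℝ) < n := by exact_mod_cast hn
  simp only [Function.comp_apply]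
  field_simp

/-- In the disc `|z + 1| < 1` the power `(z + 1) ^ (n + m)` is negligible, and the last term of the
low part of the binomial expansion, of order `n ^ (m - 1)`, dominates. -/
theorem asympOnCompacts_Q_inside {m : ℕ} (hm : 1 ≤ m) :
    AsympOnCompacts (fun n z => (Q n m).eval z / (n : ℂ) ^ (m - 1))
      (fun _ z => -(1 / (z * ((m - 1).factorial : ℂ)))) {z : ℂ | ‖z + 1‖ < 1} := by
  obtain ⟨p, rfl⟩ : ∃ p, m = p + 1 := ⟨m - 1, by omega⟩
  rw [add_tsub_cancel_right]
  refine ⟨fun n z => (p.factorial * ((n + (p + 1)).choose p : ℂ) / (n : ℂ) ^ p - 1) -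
    p.factorial / ((n : ℂ) ^ p * z ^ p) * ((z + 1) ^ (n + (p + 1)) -
      ∑ j ∈ Finset.range p, ((n + (p + 1)).choose j : ℂ) * z ^ j), fun n hn z hz => ?_,
    fun K hK hKc => ?_⟩
  · have hz : ‖z + 1‖ < 1 := hz
    have hz0 : z ≠ 0 := by
      rintro rfl
      simp at hz
    have hn0 : (n : ℂ) ≠ 0 := by exact_mod_cast (by omega : n ≠ 0)
    have hp0 : (p.factorial : ℂ) ≠ 0 := by exact_mod_cast p.factorial_ne_zero
    have h := eval_Q_mul_pow n (p + 1) z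
    rw [lowPart, Finset.sum_range_succ, eval_add, eval_finsetSum] at h
    simp only [eval_mul, eval_C, eval_pow, eval_X] at h
    field_simp
    linear_combination (p.factorial : ℂ) * h
  · rcases K.eq_empty_or_nonempty with rfl | hne
    · exact tendstoUniformlyOn_empty
    obtain ⟨z₀, hz₀, hmax⟩ := hKc.exists_isMaxOn hne (f := fun z : ℂ => ‖z + 1‖) (by fun_prop)
    have hq : ‖z₀ + 1‖ < 1 := hK hz₀
    set q := ‖z₀ + 1‖ with hqdef
    have hq0 : 0 ≤ q := norm_nonneg _
    have hlim : Tendsto (fun n : ℕ =>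
        |p.factorial * (((n + (p + 1)).choose p : ℝ) / (n : ℝ) ^ p) - 1| +
        p.factorial / (1 - q) ^ p * (q ^ n +
          ∑ j ∈ Finset.range p, ((n + (p + 1)).choose j : ℝ) / (n : ℝ) ^ p * 2 ^ j))
        atTop (𝓝 0) := by
      have h1 := (((tendsto_choose_add_div_pow (p + 1) p).const_mul (p.factorial : ℝ)).sub_const
        1).abs
      have h2 : Tendsto (fun n : ℕ => ∑ j ∈ Finset.range p,
          ((n + (p + 1)).choose j : ℝ) / (n : ℝ) ^ p * 2 ^ j) atTop
          (𝓝 (∑ j ∈ Finset.range p, 0 * 2 ^ j)) :=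
        tendsto_finsetSum _ fun j hj =>
          (tendsto_choose_add_div_pow_of_lt (p + 1) (Finset.mem_range.1 hj)).mul_const _
      have h3 := h1.add (((tendsto_pow_atTop_nhds_zero_of_lt_one hq0 hq).add h2).const_mul
        (p.factorial / (1 - q) ^ p))
      have hp0 : (p.factorial : ℝ) ≠ 0 := by exact_mod_cast p.factorial_ne_zero
      simpa [mul_inv_cancel₀ hp0] using h3
    rw [Metric.tendstoUniformlyOn_iff]
    intro ε hε
    filter_upwards [hlim.eventually (gt_mem_nhds hε), eventually_ge_atTop 1] with n hn hn1 z hz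
    have hzq : ‖z + 1‖ ≤ q := hmax hz
    have hzl : 1 - q ≤ ‖z‖ := by
      have := norm_sub_norm_le (1 : ℂ) (z + 1)
      rw [norm_one, norm_sub_rev, add_sub_cancel_right] at this
      linarith
    have hzu : ‖z‖ ≤ 2 := by
      have := norm_sub_le (z + 1) 1
      rw [add_sub_cancel_right, norm_one] at this
      linarith
    have hn' : (1 : ℝ) ≤ n := by exact_mod_cast hn1
    rw [dist_zero_left]
    refine lt_of_le_of_lt ?_ hn
    refine (norm_sub_le _ _).trans (add_le_add (le_of_eq ?_) ?_)
    · rw [← Real.norm_eq_abs, ← Complex.norm_real]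
      push_cast
      rw [mul_div_assoc]
    · have hsum : ‖(z + 1) ^ (n + (p + 1)) -
          ∑ j ∈ Finset.range p, ((n + (p + 1)).choose j : ℂ) * z ^ j‖ ≤
          q ^ n + ∑ j ∈ Finset.range p, ((n + (p + 1)).choose j : ℝ) * 2 ^ j := by
        refine (norm_sub_le _ _).trans (add_le_add ?_ (norm_sum_le_of_le _ fun j _ => ?_))
        · rw [norm_pow]
          exact (pow_le_pow_left₀ (norm_nonneg _) hzq _).trans
            (pow_le_pow_of_le_one hq0 hq.le (by omega))
        · rw [norm_mul, norm_pow, Complex.norm_natCast]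
          gcongr
      have hq1 : 0 < 1 - q := by linarith
      rw [norm_mul, norm_div, norm_mul, norm_pow, norm_pow, Complex.norm_natCast,
        Complex.norm_natCast]
      calc (p.factorial : ℝ) / ((n : ℝ) ^ p * ‖z‖ ^ p) * ‖(z + 1) ^ (n + (p + 1)) -
            ∑ j ∈ Finset.range p, ((n + (p + 1)).choose j : ℂ) * z ^ j‖
          ≤ (p.factorial : ℝ) / ((n : ℝ) ^ p * (1 - q) ^ p) *
            (q ^ n + ∑ j ∈ Finset.range p, ((n + (p + 1)).choose j : ℝ) * 2 ^ j) := by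
            gcongr
        _ = p.factorial / (1 - q) ^ p * (q ^ n / (n : ℝ) ^ p +
            ∑ j ∈ Finset.range p, ((n + (p + 1)).choose j : ℝ) / (n : ℝ) ^ p * 2 ^ j) := by
            simp only [div_mul_eq_mul_div, ← Finset.sum_div]
            field_simp
        _ ≤ _ := by
            gcongr
            exact div_le_self (by positivity) (one_le_pow₀ hn')

/-! ### The zero counting measures -/

theorem eventually_abs_norm_root_Q_sub_one_le {m : ℕ} (hm : 1 ≤ m) {δ : ℝ} (hδ : 0 < δ) :
    ∀ᶠ n in atTop, ∀ ζ ∈ (Q n m).roots, |‖ζ + 1‖ - 1| ≤ δ := by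
  obtain ⟨ε, hfg, hε⟩ := asympOnCompacts_Q_inside hm
  have hK : Metric.closedBall (-1 : ℂ) (1 - δ) ⊆ {z : ℂ | ‖z + 1‖ < 1} := fun z hz => by
    rw [mem_closedBall_iff_norm, sub_neg_eq_add] at hz
    exact hz.trans_lt (by linarith)
  have hin := Metric.tendstoUniformlyOn_iff.1 (hε _ hK (isCompact_closedBall _ _)) 1 one_pos
  have hout := (tendsto_lowPart_bound m (q := 1 + δ) (by linarith)).eventually
    (gt_mem_nhds one_pos)
  filter_upwards [hin, hout, eventually_ge_atTop 1] with n hn_in hn_out hn1 ζ hζ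
  have hroot : (Q n m).eval ζ = 0 := (mem_roots'.1 hζ).2
  by_contra hcon
  rcases lt_abs.1 (not_le.1 hcon) with h | h
  · have hw : 1 + δ ≤ ‖ζ + 1‖ := by linarith
    have hid := eval_Q_mul_pow n m ζ
    rw [hroot, mul_zero, eq_comm, sub_eq_zero] at hid
    have hle := norm_eval_lowPart_le n m (z := ζ) (by linarith)
    rw [← hid, norm_pow, pow_add] at hle
    have hle' := le_of_mul_le_mul_right hle (pow_pos (by linarith) m)
    rw [div_lt_one (by positivity)] at hn_out
    exact absurd (pow_le_pow_left₀ (by linarith) hw n) (by linarith)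
  · have hz : ζ ∈ Metric.closedBall (-1 : ℂ) (1 - δ) := by
      rw [mem_closedBall_iff_norm, sub_neg_eq_add]
      linarith
    have hlt : ‖ζ + 1‖ < 1 := hK hz
    have hz0 : ζ ≠ 0 := by
      rintro rfl
      simp at hlt
    have h0 := hfg n hn1 ζ (hK hz)
    have hsmall := hn_in ζ hz
    rw [dist_zero_left] at hsmall
    have hfac : ((m - 1).factorial : ℂ) ≠ 0 := by exact_mod_cast (m - 1).factorial_ne_zero
    simp only [hroot] at h0
    rw [zero_div, eq_comm, mul_eq_zero] at h0
    have h1 := h0.resolve_left (by simp [hz0, hfac])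
    rw [(eq_neg_of_add_eq_zero_right h1), norm_neg, norm_one] at hsmall
    exact lt_irrefl _ hsmall

theorem integrable_sum_dirac {E : Type*} [NormedAddCommGroup E] (s : Multiset ℂ) (f : ℂ → E) :
    Integrable f (s.map fun ζ => Measure.dirac ζ).sum := by
  induction s using Multiset.induction_on with
  | empty => simp
  | cons a s ih =>
    rw [Multiset.map_cons, Multiset.sum_cons]
    exact (integrable_dirac enorm_lt_top).add_measure ih

theorem integral_sum_dirac {E : Type*} [NormedAddCommGroup E] [NormedSpace ℝ E] [CompleteSpace E]
    (s : Multiset ℂ) (f : ℂ → E) :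
    ∫ z, f z ∂(s.map fun ζ => Measure.dirac ζ).sum = (s.map f).sum := by
  induction s using Multiset.induction_on with
  | empty => simp
  | cons a s ih =>
    rw [Multiset.map_cons, Multiset.sum_cons, integral_add_measure
      (integrable_dirac enorm_lt_top) (integrable_sum_dirac s f), ih, integral_dirac,
      Multiset.map_cons, Multiset.sum_cons]

theorem ae_sum_dirac {s : Multiset ℂ} {P : ℂ → Prop} (h : ∀ ζ ∈ s, P ζ) :
    ∀ᵐ z ∂(s.map fun ζ => Measure.dirac ζ).sum, P z := by
  induction s using Multiset.induction_on with
  | empty => simp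
  | cons a s ih =>
    rw [Multiset.map_cons, Multiset.sum_cons, ae_add_measure_iff]
    refine ⟨?_, ih fun ζ hζ => h ζ (Multiset.mem_cons_of_mem hζ)⟩
    rw [ae_dirac_eq]
    exact h a (Multiset.mem_cons_self a s)

theorem sum_dirac_univ (s : Multiset ℂ) :
    (s.map fun ζ => Measure.dirac ζ).sum Set.univ = Multiset.card s := by
  induction s using Multiset.induction_on with
  | empty => simp
  | cons a s ih =>
    rw [Multiset.map_cons, Multiset.sum_cons, Measure.add_apply, ih, measure_univ,
      Multiset.card_cons]
    push_cast
    ring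

theorem isProbabilityMeasure_zeroMeasure {p : ℂ[X]} (hp : p.natDegree ≠ 0) :
    IsProbabilityMeasure (zeroMeasure p) := by
  constructor
  rw [zeroMeasure, Measure.smul_apply, sum_dirac_univ,
    splits_iff_card_roots.1 (IsAlgClosed.splits p), smul_eq_mul]
  exact ENNReal.inv_mul_cancel (by exact_mod_cast hp) (ENNReal.natCast_ne_top _)

theorem tendsto_integral_zeroMeasure_Q {m : ℕ} (hm : 1 ≤ m) (f : BoundedContinuousFunction ℂ ℝ) :
    Tendsto (fun n : ℕ => ∫ z, f z ∂zeroMeasure (Q n m)) atTop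
      (𝓝 (∫ z, f z ∂normalizedArcLength (-1) 1)) := by
  -- `Q 0 m` is constant, so its zero measure is not a probability measure
  rw [← tendsto_add_atTop_iff_nat 1]
  have h : Tendsto (fun n : ℕ => ∫ z, (f z : ℂ) ∂zeroMeasure (Q (n + 1) m)) atTop
      (𝓝 (∫ z, (f z : ℂ) ∂normalizedArcLength (-1) 1)) := by
    refine tendsto_integral_normalizedArcLength
      (fun n => isProbabilityMeasure_zeroMeasure (by rw [natDegree_Q]; omega))
      (fun δ hδ => ?_) (fun k hk => ?_) (by fun_prop)
    · have := (tendsto_add_atTop_nat 1).eventually (eventually_abs_norm_root_Q_sub_one_le hm hδ)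
      filter_upwards [this] with n hn
      simp only [sub_neg_eq_add]
      exact Measure.ae_smul_measure (ae_sum_dirac hn) _
    · have h1 : Tendsto (fun n : ℕ => ((((n + 1 : ℕ) : ℝ)⁻¹ : ℝ) : ℂ) * (-m)) atTop
          (𝓝 (((0 : ℝ) : ℂ) * (-m))) :=
        (((Complex.continuous_ofReal.tendsto 0).comp
          (tendsto_inv_atTop_nhds_zero_nat.comp (tendsto_add_atTop_nat 1)))).mul_const _
      rw [Complex.ofReal_zero, zero_mul] at h1
      refine h1.congr' ?_
      filter_upwards [eventually_ge_atTop k] with n hn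
      simp only [sub_neg_eq_add]
      rw [zeroMeasure, integral_smul_measure, integral_sum_dirac,
        sum_roots_Q_add_one_pow hk (by omega), natDegree_Q, ENNReal.toReal_inv,
        ENNReal.toReal_natCast, Complex.real_smul]
  simp only [integral_complex_ofReal] at h
  have h' := (Complex.continuous_re.tendsto _).comp h
  simpa [Function.comp_def] using h'

end IteratedIntegral

theorem mainTheorem6 (m : ℕ) (hm : 1 ≤ m) :
    IteratedIntegral.AsympOnCompacts
      (fun n z => (IteratedIntegral.Q n m).eval z / (n : ℂ) ^ (m - 1))
      (fun n z => (z + 1) ^ (n + m) / ((n : ℂ) ^ (m - 1) * z ^ m))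
      {z : ℂ | 1 < ‖z + 1‖} ∧
    IteratedIntegral.AsympOnCompacts
      (fun n z => (IteratedIntegral.Q n m).eval z / (n : ℂ) ^ (m - 1))
      (fun _ z => -(1 / (z * (Nat.factorial (m - 1) : ℂ))))
      {z : ℂ | ‖z + 1‖ < 1} ∧
    (∀ f : BoundedContinuousFunction ℂ ℝ,
      Tendsto (fun n : ℕ => ∫ z, f z ∂(IteratedIntegral.zeroMeasure (IteratedIntegral.Q n m)))
        atTop (𝓝 (∫ z, f z ∂(IteratedIntegral.normalizedArcLength (-1) 1)))) ∧
    IteratedIntegral.IsEquilibriumMeasure (Metric.closedBall (-1 : ℂ) 1)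
      (IteratedIntegral.normalizedArcLength (-1) 1) ∧
    IteratedIntegral.IsEquilibriumMeasure (Metric.sphere (-1 : ℂ) 1)
      (IteratedIntegral.normalizedArcLength (-1) 1) := by
  exact ⟨IteratedIntegral.asympOnCompacts_Q_outside m, IteratedIntegral.asympOnCompacts_Q_inside hm,
    IteratedIntegral.tendsto_integral_zeroMeasure_Q hm,
    IteratedIntegral.isEquilibriumMeasure_normalizedArcLength Metric.sphere_subset_closedBall
      subset_rfl,
    IteratedIntegral.isEquilibriumMeasure_normalizedArcLength subset_rfl
      Metric.sphere_subset_closedBall⟩
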